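/- **Theorem (improved credit bounds for the credit-based shaper).** A transmission line of rate $c>0$ serves the following classes, in decreasing priority: one Control-Data-Traffic (CDT) class, $p$ AVB classes $1,\dots,p$, and a finite number of best-effort (BE) classes. AVB class $i$ has an idle slope $I_i>0$ and a send slope $S_i<0$ with $I_i-S_i=c$, and $\sum_{j=1}^p I_j<c$. Packets of AVB class $i$ have length at most $L_i$, and packets of BE classes have length at most $L_{BE}$. Let $\bar L_i=\max(L_{BE},L_{>i})$, where $L_{>i}$ is the maximum packet length of the classes of lower priority than AVB class $i$. Each class has a queue with a gate; a class whose gate is closed does not transmit. A class is backlogged when it has a packet that has arrived and has not been completely transmitted. The credit $V_i(t)$, $t\ge 0$, of AVB class $i$ starts at $V_i(0)=0$, and the system is empty before time $0$; only finitely many events occur in bounded time, and between events every credit is affine in $t$. The scheduler obeys the following rules. * R1. When the line is free, it begins to transmit a packet of the highest-priority class that is backlogged, has an open gate and, if it is an AVB class, has a nonnegative credit; it stays idle only if there is no such class. A packet whose transmission has begun occupies the line until it is finished, except that CDT may interrupt an AVB or BE packet, which resumes before any other AVB or BE packet begins. CDT may be preemptive or not, and it may withhold the line from the other classes (overhead,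 hold, guard band) at any time. * R2. While AVB class $i$ transmits, $V_i$ has slope $S_i$. * R3. While class $i$ is backlogged, its gate is open and another AVB or BE class transmits, $V_i$ has slope $I_i$. While class $i$ is backlogged, its gate is open and the line is idle, $V_i$ has slope $0$ or $I_i$. * R4. $V_i$ is constant while the gate of class $i$ is closed, while CDT transmits, and while the line is withheld for CDT. * R5. If class $i$ becomes non-backlogged while $V_i>0$, then $V_i$ is reset to $0$. While class $i$ is not backlogged and $V_i<0$, $V_i$ has slope $I_i$ until it reaches $0$, except when it is constant by R4; it then stays at $0$. Apart from the resets, $V_i$ is continuous. The gates close for the benefit of CDT: whenever the gate of some AVB or BE class is open, the gates of all AVB classes are open. Then, for every AVB class $i$ and all $t\ge 0$, $$V_i(t)\le V_i^{\max}=\frac{I_i}{c\,\bigl(c-\sum_{j=1}^{i-1}I_j\bigr)}\Bigl(c\,\bar L_i-\sum_{j=1}^{i-1}S_jL_j\Bigr).$$ -/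

import Mathlib

open scoped BigOperators

noncomputable section

namespace CBS

/-- Traffic classes: one CDT class, `p` AVB classes and `q` best-effort classes.
The AVB class numbered `j` in `1, ..., p` is `avb` of the element `j - 1` of `Fin p`. -/
inductive TClass (p q : ℕ) : Type where
  | cdt : TClass p q
  | avb : Fin p → TClass p q
  | be : Fin q → TClass p q

/-- Rank of a class in the priority order; a smaller rank is a higher priority. -/
def TClass.rank {p q : ℕ} : TClass p q → ℕ
  | .cdt => 0
  | .avb j => j.val + 1
  | .be k => p + 1 + k.val

/-- Parameters of the scheduler. -/
structure Params (p q : ℕ) where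
  /-- line transmission rate -/
  c : ℝ
  /-- idle slopes -/
  I : Fin p → ℝ
  /-- send slopes -/
  S : Fin p → ℝ
  /-- maximum packet lengths of the AVB classes -/
  L : Fin p → ℝ
  /-- maximum packet lengths of the best-effort classes -/
  LB : Fin q → ℝ
  c_pos : 0 < c
  I_pos : ∀ j, 0 < I j
  S_neg : ∀ j, S j < 0
  slope_eq : ∀ j, I j - S j = c
  sum_lt : ∑ j, I j < c
  L_pos : ∀ j, 0 < L j
  LB_pos : ∀ k, 0 < LB k

/-- Maximum packet length over the best-effort classes (`0` if there is none). -/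
def Params.LBE {p q : ℕ} (P : Params p q) : ℝ := ⨆ k : Fin q, P.LB k

/-- Maximum packet length over the AVB classes of lower priority than the AVB class `i`
(`0` if there is none). -/
def Params.Lgt {p q : ℕ} (P : Params p q) (i : Fin p) : ℝ := ⨆ j : {j : Fin p // i < j}, P.L j

/-- Maximum packet length over all classes of lower priority than the AVB class `i`. -/
def Params.Lbar {p q : ℕ} (P : Params p q) (i : Fin p) : ℝ := max P.LBE (P.Lgt i)

/-- What the transmission line does at an instant: nothing; being withheld from all AVB and BE
classes by the mechanism that integrates CDT (preemption overhead, hold, guard band); or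
transmitting a given packet. -/
inductive LineState (Pkt : Type*) where
  | idle : LineState Pkt
  | overhead : LineState Pkt
  | tx : Pkt → LineState Pkt

/-- The raw data of a run of the scheduler over the times `t ≥ 0`. Functions of time are read as
right-continuous: the value at an instant is the one that holds just after the events there. -/
structure Trace (p q : ℕ) (Pkt : Type*) where
  /-- class of a packet -/
  cls : Pkt → TClass p q
  /-- length of a packet -/
  len : Pkt → ℝ
  /-- arrival time of a packet -/
  arr : Pkt → ℝ
  /-- `gate k t`: the gate of class `k` is open at time `t` -/
  gate : TClass p q → ℝ → Prop
  /-- state of the line -/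
  line : ℝ → LineState Pkt
  /-- credits of the AVB classes -/
  V : Fin p → ℝ → ℝ
  /-- slopes of the credits (right derivatives) -/
  rate : Fin p → ℝ → ℝ
  /-- event times, between which nothing switches -/
  τ : ℕ → ℝ

namespace Trace

variable {p q : ℕ} {Pkt : Type*}

/-- Amount of packet `x` that a line of rate `c` has transmitted in `[0, t)`. -/
def served (T : Trace p q Pkt) (c : ℝ) (x : Pkt) (t : ℝ) : ℝ :=
  c * (MeasureTheory.volume {u : ℝ | 0 ≤ u ∧ u < t ∧ T.line u = LineState.tx x}).toReal

/-- The transmission of packet `x` has begun before time `t` and is not finished at `t`. -/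
def InProgress (T : Trace p q Pkt) (c : ℝ) (x : Pkt) (t : ℝ) : Prop :=
  0 < T.served c x t ∧ T.served c x t < T.len x

/-- Class `k` has a positive backlog at time `t`. -/
def Backlogged (T : Trace p q Pkt) (c : ℝ) (k : TClass p q) (t : ℝ) : Prop :=
  ∃ x, T.cls x = k ∧ T.arr x ≤ t ∧ T.served c x t < T.len x

/-- Class `k` is transmitting at time `t`. -/
def Transmits (T : Trace p q Pkt) (k : TClass p q) (t : ℝ) : Prop :=
  ∃ x, T.line t = LineState.tx x ∧ T.cls x = k

/-- The credit of class `k` is nonnegative at time `t`, if `k` is an AVB class. -/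
def CreditOK (T : Trace p q Pkt) : TClass p q → ℝ → Prop
  | .avb j, t => 0 ≤ T.V j t
  | _, _ => True

/-- The three conditions under which class `k` may begin a transmission at time `t`. -/
def Eligible (T : Trace p q Pkt) (c : ℝ) (k : TClass p q) (t : ℝ) : Prop :=
  T.Backlogged c k t ∧ T.gate k t ∧ T.CreditOK k t

/-- `T` is a run of the credit-based shaper with parameters `P`: the packets respect the maximum
lengths, the system is empty before time `0` and the credits start at `0`, there are finitely many
events in bounded time, and the rules R1 to R5 hold. -/
structure IsRun (T : Trace p q Pkt) (P : Params p q) : Prop where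
  len_pos : ∀ x, 0 < T.len x
  len_avb : ∀ x j, T.cls x = .avb j → T.len x ≤ P.L j
  len_be : ∀ x k, T.cls x = .be k → T.len x ≤ P.LB k
  arr_nonneg : ∀ x, 0 ≤ T.arr x
  -- event times
  τ_zero : T.τ 0 = 0
  τ_strictMono : StrictMono T.τ
  τ_tendsto : Filter.Tendsto T.τ Filter.atTop Filter.atTop
  line_const : ∀ n, ∀ t ∈ Set.Ico (T.τ n) (T.τ (n + 1)), T.line t = T.line (T.τ n)
  rate_const : ∀ n, ∀ t ∈ Set.Ico (T.τ n) (T.τ (n + 1)), ∀ i, T.rate i t = T.rate i (T.τ n)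
  -- credits are zero at time `0`, affine between events, and continuous except at resets
  V_zero : ∀ i, T.V i 0 = 0
  V_affine : ∀ n, ∀ t ∈ Set.Ico (T.τ n) (T.τ (n + 1)), ∀ i,
    T.V i t = T.V i (T.τ n) + T.rate i (T.τ n) * (t - T.τ n)
  V_cont : ∀ n i,
    (T.Backlogged P.c (.avb i) (T.τ (n + 1)) ∨
      T.V i (T.τ n) + T.rate i (T.τ n) * (T.τ (n + 1) - T.τ n) ≤ 0) →
    T.V i (T.τ (n + 1)) = T.V i (T.τ n) + T.rate i (T.τ n) * (T.τ (n + 1) - T.τ n)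
  /-- R5, credit reset: a positive credit is set to zero when the backlog becomes zero. -/
  R5_reset : ∀ n i, ¬ T.Backlogged P.c (.avb i) (T.τ (n + 1)) →
    0 < T.V i (T.τ n) + T.rate i (T.τ n) * (T.τ (n + 1) - T.τ n) →
    T.V i (T.τ (n + 1)) = 0
  /-- Only packets that are present are transmitted, and only through open gates. -/
  tx_valid : ∀ t, 0 ≤ t → ∀ x, T.line t = LineState.tx x →
    T.arr x ≤ t ∧ T.served P.c x t < T.len x ∧ T.gate (T.cls x) t
  /-- A packet whose transmission has begun occupies the line until it is finished, except that an
  AVB or BE packet may be interrupted by CDT; whether and when it is depends on the integration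
  policy, which is left open. -/
  in_progress : ∀ t, 0 ≤ t → ∀ y, T.InProgress P.c y t →
    T.line t = LineState.tx y ∨ T.line t = LineState.overhead ∨
      (T.cls y ≠ .cdt ∧ T.Transmits .cdt t)
  /-- R1: a packet whose transmission begins belongs to the highest-priority eligible class. -/
  R1_select : ∀ t, 0 ≤ t → ∀ x, T.line t = LineState.tx x → T.served P.c x t = 0 →
    T.Eligible P.c (T.cls x) t ∧
      ∀ k : TClass p q, k.rank < (T.cls x).rank → ¬ T.Eligible P.c k t
  /-- R1: the line does not stay free when a class is eligible. -/
  R1_work : ∀ t, 0 ≤ t → T.line t = LineState.idle → ∀ k, ¬ T.Eligible P.c k t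
  /-- R2 -/
  R2 : ∀ t, 0 ≤ t → ∀ i, T.Transmits (.avb i) t → T.rate i t = P.S i
  /-- R3: the credit increases while the class waits for another AVB or BE class. -/
  R3 : ∀ t, 0 ≤ t → ∀ i, T.gate (.avb i) t → T.Backlogged P.c (.avb i) t →
    (∃ k, k ≠ .cdt ∧ k ≠ .avb i ∧ T.Transmits k t) → T.rate i t = P.I i
  /-- R3 does not let a backlogged class gain credit on an idle line, the usual convention for a
  negative credit does; both are allowed. -/
  R3_idle : ∀ t, 0 ≤ t → ∀ i, T.gate (.avb i) t → T.Backlogged P.c (.avb i) t →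
    T.line t = LineState.idle → T.rate i t = 0 ∨ T.rate i t = P.I i
  /-- R4: closed gate. -/
  R4_gate : ∀ t, 0 ≤ t → ∀ i, ¬ T.gate (.avb i) t → T.rate i t = 0
  /-- R4: overhead of the integration of CDT. -/
  R4_overhead : ∀ t, 0 ≤ t → ∀ i, T.line t = LineState.overhead → T.rate i t = 0
  /-- All credits are frozen while CDT transmits. -/
  frozen_cdt : ∀ t, 0 ≤ t → ∀ i, T.Transmits .cdt t → T.rate i t = 0
  /-- R5, recovery: without backlog a negative credit increases, unless it is frozen. -/
  R5_recover : ∀ t, 0 ≤ t → ∀ i, ¬ T.Backlogged P.c (.avb i) t → T.V i t < 0 →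
    T.gate (.avb i) t → T.line t ≠ LineState.overhead → ¬ T.Transmits .cdt t → T.rate i t = P.I i
  /-- R5: the recovery ends at the zero value. -/
  R5_zero : ∀ t, 0 ≤ t → ∀ i, ¬ T.Backlogged P.c (.avb i) t → 0 ≤ T.V i t → T.rate i t = 0

end Trace

end CBS

end

/-! For a class `i`, put slack = c − Σ_{j<i} I_j and follow the weighted credit Φ = slack·V_i +
I_i·Σ_{j<i} V_j (`potential`). The weights are chosen so that Φ cannot grow while class `i` or a
higher AVB class transmits (`potential_rate_nonpos`). Φ is frozen during CDT and overhead, and an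
idle line cannot raise it above max(0, Φ) (`potential_idle`). Only a lower-priority packet can push
Φ above zero. When such a packet begins, no class up to `i` is eligible although the gates are open,
so all their credits are at most 0. From then on Φ gains at most I_i per unit of length served.
Hence Φ ≤ I_i·L̄_i (`potential_le`). In the other direction, V_j falls only while class `j`
transmits, and a packet begins only at nonnegative credit, so V_j ≥ S_j·L_j/c (`le_V`). Inserting
this for j < i into the bound on Φ and dividing by slack gives the theorem. CDT may interrupt
packets, so both bounds are proved by induction over events (`invariant`), strengthened by a bound
in terms of the amount served of any packet in progress. -/

namespace CBS

namespace Params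

variable {p q : ℕ} (P : Params p q)

/-- The part of the line rate that is not reserved for the AVB classes above class `i`. -/
def slack (i : Fin p) : ℝ := P.c - ∑ j ∈ Finset.univ.filter (fun j => j < i), P.I j

lemma I_lt_slack (i : Fin p) : P.I i < P.slack i := by
  have h : ∑ j ∈ insert i (Finset.univ.filter (fun j => j < i)), P.I j ≤ ∑ j, P.I j :=
    Finset.sum_le_sum_of_subset_of_nonneg (Finset.subset_univ _) fun j _ _ => (P.I_pos j).le
  rw [Finset.sum_insert (by simp)] at h
  have := P.sum_lt
  unfold slack
  linarith

lemma slack_pos (i : Fin p) : 0 < P.slack i := (P.I_pos i).trans (P.I_lt_slack i)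

lemma Lbar_nonneg (i : Fin p) : 0 ≤ P.Lbar i :=
  le_max_of_le_left (Real.iSup_nonneg fun k => (P.LB_pos k).le)

lemma LB_le_Lbar (i : Fin p) (k : Fin q) : P.LB k ≤ P.Lbar i :=
  le_max_of_le_left (le_ciSup (Set.finite_range P.LB).bddAbove k)

lemma L_le_Lbar {i j : Fin p} (h : i < j) : P.L j ≤ P.Lbar i :=
  le_max_of_le_right (le_ciSup (f := fun j : {j : Fin p // i < j} => P.L j)
    (Set.finite_range _).bddAbove ⟨j, h⟩)

end Params

namespace Trace

variable {p q : ℕ} {Pkt : Type*} {P : Params p q} {T : Trace p q Pkt}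

/-! ### Service received by a packet -/

section served

variable {c s t : ℝ} {x : Pkt}

lemma served_nonneg (T : Trace p q Pkt) (hc : 0 ≤ c) (x : Pkt) (t : ℝ) : 0 ≤ T.served c x t :=
  mul_nonneg hc ENNReal.toReal_nonneg

lemma served_zero (T : Trace p q Pkt) (c : ℝ) (x : Pkt) : T.served c x 0 = 0 := by
  have : {u : ℝ | 0 ≤ u ∧ u < 0 ∧ T.line u = LineState.tx x} = ∅ := by
    ext u; simp only [Set.mem_ofPred_eq, Set.mem_empty_iff_false, iff_false]
    rintro ⟨h, h', -⟩; linarith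
  simp [served, this]

lemma served_of_tx (hs : 0 ≤ s) (hst : s ≤ t)
    (h : ∀ u ∈ Set.Ico s t, T.line u = LineState.tx x) :
    T.served c x t = T.served c x s + c * (t - s) := by
  have hset : {u : ℝ | 0 ≤ u ∧ u < t ∧ T.line u = LineState.tx x} =
      {u : ℝ | 0 ≤ u ∧ u < s ∧ T.line u = LineState.tx x} ∪ Set.Ico s t := by
    ext u
    simp only [Set.mem_ofPred_eq, Set.mem_union, Set.mem_Ico]
    constructor
    · rintro ⟨h0, h1, h2⟩
      rcases lt_or_ge u s with h3 | h3
      · exact Or.inl ⟨h0, h3, h2⟩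
      · exact Or.inr ⟨h3, h1⟩
    · rintro (⟨h0, h1, h2⟩ | h3)
      · exact ⟨h0, h1.trans_le hst, h2⟩
      · exact ⟨hs.trans h3.1, h3.2, h u h3⟩
  have hdisj : Disjoint {u : ℝ | 0 ≤ u ∧ u < s ∧ T.line u = LineState.tx x} (Set.Ico s t) := by
    rw [Set.disjoint_left]
    intro u hu hu'
    exact absurd hu.2.1 (not_lt.mpr hu'.1)
  have hfin : MeasureTheory.volume {u : ℝ | 0 ≤ u ∧ u < s ∧ T.line u = LineState.tx x} ≠ ⊤ :=
    ne_top_of_le_ne_top (by simp : MeasureTheory.volume (Set.Ico 0 s) ≠ ⊤)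
      (MeasureTheory.measure_mono fun u hu => ⟨hu.1, hu.2.1⟩)
  unfold served
  rw [hset, MeasureTheory.measure_union hdisj measurableSet_Ico,
    ENNReal.toReal_add hfin (by simp), Real.volume_Ico, ENNReal.toReal_ofReal (by linarith)]
  ring

lemma served_of_not_tx (hst : s ≤ t)
    (h : ∀ u ∈ Set.Ico s t, T.line u ≠ LineState.tx x) :
    T.served c x t = T.served c x s := by
  have hset : {u : ℝ | 0 ≤ u ∧ u < t ∧ T.line u = LineState.tx x} =
      {u : ℝ | 0 ≤ u ∧ u < s ∧ T.line u = LineState.tx x} := by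
    ext u
    simp only [Set.mem_ofPred_eq]
    constructor
    · rintro ⟨h0, h1, h2⟩
      exact ⟨h0, lt_of_not_ge fun h3 => h u ⟨h3, h1⟩ h2, h2⟩
    · rintro ⟨h0, h1, h2⟩
      exact ⟨h0, h1.trans_le hst, h2⟩
  unfold served
  rw [hset]

end served

/-! ### The weighted credit -/

/-- The potential of class `i` for credits `v`. -/
def potential (P : Params p q) (i : Fin p) (v : Fin p → ℝ) : ℝ :=
  P.slack i * v i + P.I i * ∑ j ∈ Finset.univ.filter (fun j => j < i), v j

lemma potential_affine (i : Fin p) (v r : Fin p → ℝ) (d : ℝ) :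
    potential P i (fun j => v j + r j * d) = potential P i v + potential P i r * d := by
  simp only [potential, Finset.sum_add_distrib, ← Finset.sum_mul]
  ring

lemma potential_mono (i : Fin p) {v w : Fin p → ℝ} (h : ∀ j ≤ i, v j ≤ w j) :
    potential P i v ≤ potential P i w :=
  add_le_add (mul_le_mul_of_nonneg_left (h i le_rfl) (P.slack_pos i).le)
    (mul_le_mul_of_nonneg_left (Finset.sum_le_sum fun j hj =>
      h j (Finset.mem_filter.mp hj).2.le) (P.I_pos i).le)

lemma potential_nonpos (i : Fin p) {v : Fin p → ℝ} (h : ∀ j ≤ i, v j ≤ 0) :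
    potential P i v ≤ 0 :=
  (potential_mono i h).trans_eq (by simp [potential])

lemma potential_eq_zero (i : Fin p) {v : Fin p → ℝ} (h : ∀ j ≤ i, v j = 0) :
    potential P i v = 0 := by
  have : ∑ j ∈ Finset.univ.filter (fun j => j < i), v j = 0 :=
    Finset.sum_eq_zero fun j hj => h j (Finset.mem_filter.mp hj).2.le
  simp [potential, h i le_rfl, this]

/-- The value at `t` of the credits continued affinely from the event `n`. -/
def extendedCredit (T : Trace p q Pkt) (n : ℕ) (t : ℝ) (j : Fin p) : ℝ :=
  T.V j (T.τ n) + T.rate j (T.τ n) * (t - T.τ n)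

namespace IsRun

lemma event_nonneg (hT : T.IsRun P) (n : ℕ) : 0 ≤ T.τ n :=
  hT.τ_zero ▸ hT.τ_strictMono.monotone (Nat.zero_le n)

lemma exists_mem_Ico (hT : T.IsRun P) {t : ℝ} (ht : 0 ≤ t) :
    ∃ n, t ∈ Set.Ico (T.τ n) (T.τ (n + 1)) := by
  classical
  have hex : ∃ n, t < T.τ n := (hT.τ_tendsto.eventually_gt_atTop t).exists
  obtain ⟨n, hn⟩ : ∃ n, Nat.find hex = n + 1 := by
    refine Nat.exists_eq_succ_of_ne_zero fun h0 => ?_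
    have := Nat.find_spec hex
    rw [h0, hT.τ_zero] at this
    linarith
  exact ⟨n, not_lt.mp (Nat.find_min hex (by omega)), hn ▸ Nat.find_spec hex⟩

/-! ### Slopes of the credits and of the potential -/

/-- The credit of a class that is not transmitting is constant or grows at the idle slope. -/
lemma rate_cases (hT : T.IsRun P) {t : ℝ} (ht : 0 ≤ t) (j : Fin p)
    (hj : ¬ T.Transmits (.avb j) t) : T.rate j t = 0 ∨ T.rate j t = P.I j := by
  by_cases hg : T.gate (.avb j) t
  swap
  · exact Or.inl (hT.R4_gate t ht j hg)
  by_cases hcdt : T.Transmits .cdt t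
  · exact Or.inl (hT.frozen_cdt t ht j hcdt)
  by_cases hov : T.line t = LineState.overhead
  · exact Or.inl (hT.R4_overhead t ht j hov)
  by_cases hb : T.Backlogged P.c (.avb j) t
  · cases hl : T.line t with
    | idle => exact hT.R3_idle t ht j hg hb hl
    | overhead => exact absurd hl hov
    | tx x =>
      exact Or.inr (hT.R3 t ht j hg hb ⟨T.cls x, fun h => hcdt ⟨x, hl, h⟩,
        fun h => hj ⟨x, hl, h⟩, x, hl, rfl⟩)
  · rcases lt_or_ge (T.V j t) 0 with hV | hV
    · exact Or.inr (hT.R5_recover t ht j hb hV hg hov hcdt)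
    · exact Or.inl (hT.R5_zero t ht j hb hV)

lemma rate_nonneg (hT : T.IsRun P) {t : ℝ} (ht : 0 ≤ t) (j : Fin p)
    (hj : ¬ T.Transmits (.avb j) t) : 0 ≤ T.rate j t := by
  rcases hT.rate_cases ht j hj with h | h <;> rw [h]
  exact (P.I_pos j).le

lemma rate_le (hT : T.IsRun P) {t : ℝ} (ht : 0 ≤ t) (j : Fin p) : T.rate j t ≤ P.I j := by
  by_cases hj : T.Transmits (.avb j) t
  · rw [hT.R2 t ht j hj]
    exact ((P.S_neg j).trans (P.I_pos j)).le
  · rcases hT.rate_cases ht j hj with h | h <;> rw [h]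
    exact (P.I_pos j).le

/-- Since slack + Σ_{j<i} I_j = c, idle slopes throughout give exactly I_i·c, that is, I_i per unit
of length served. -/
lemma potential_rate_le (hT : T.IsRun P) {t : ℝ} (ht : 0 ≤ t) (i : Fin p) :
    potential P i (fun j => T.rate j t) ≤ P.I i * P.c := by
  refine (potential_mono i fun j _ => hT.rate_le ht j).trans_eq ?_
  simp only [potential, Params.slack]
  ring

/-- The potential does not grow while class `i` or a class above it transmits. -/
lemma potential_rate_nonpos (hT : T.IsRun P) {t : ℝ} (ht : 0 ≤ t) {i k : Fin p} (hk : k ≤ i)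
    (htx : T.Transmits (.avb k) t) : potential P i (fun j => T.rate j t) ≤ 0 := by
  have hS := hT.R2 t ht k htx
  have hSk := P.slope_eq k
  rcases hk.eq_or_lt with rfl | hlt
  -- For k = i the slope is at most slack·(I_i − c) + I_i·(c − slack) = c·(I_i − slack), negative by
  -- `I_lt_slack`.
  · have hsum : ∑ j ∈ Finset.univ.filter (fun j => j < k), T.rate j t ≤
        ∑ j ∈ Finset.univ.filter (fun j => j < k), P.I j :=
      Finset.sum_le_sum fun j _ => hT.rate_le ht j
    have hlt := P.I_lt_slack k
    have hc := P.c_pos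
    have hmul := mul_le_mul_of_nonneg_left hsum (P.I_pos k).le
    have hneg : P.c * (P.I k - P.slack k) ≤ 0 :=
      mul_nonpos_of_nonneg_of_nonpos hc.le (by linarith)
    have hS' : T.rate k t = P.I k - P.c := by linarith
    have hsl : ∑ j ∈ Finset.univ.filter (fun j => j < k), P.I j = P.c - P.slack k := by
      simp [Params.slack]
    rw [hsl] at hmul
    simp only [potential, hS']
    linarith
  -- For k < i, S_k = I_k − c brings the sum of the higher slopes down to at most −slack, which
  -- cancels the gain slack·I_i.
  · have hmem : k ∈ Finset.univ.filter (fun j => j < i) := by simpa using hlt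
    have hsum : ∑ j ∈ Finset.univ.filter (fun j => j < i), T.rate j t ≤ -P.slack i := by
      have hle : ∑ j ∈ (Finset.univ.filter (fun j => j < i)).erase k, T.rate j t ≤
          ∑ j ∈ (Finset.univ.filter (fun j => j < i)).erase k, P.I j :=
        Finset.sum_le_sum fun j _ => hT.rate_le ht j
      rw [← Finset.add_sum_erase _ _ hmem]
      have := Finset.add_sum_erase _ P.I hmem
      simp only [Params.slack]
      linarith
    have h1 := mul_le_mul_of_nonneg_left hsum (P.I_pos i).le
    have h2 := mul_le_mul_of_nonneg_left (hT.rate_le ht i) (P.slack_pos i).le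
    simp only [potential]
    linarith

lemma potential_rate_frozen (hT : T.IsRun P) {t : ℝ} (ht : 0 ≤ t) (i : Fin p)
    (h : T.line t = LineState.overhead ∨ T.Transmits .cdt t) :
    potential P i (fun j => T.rate j t) = 0 :=
  potential_eq_zero i fun j _ =>
    h.elim (fun h => hT.R4_overhead t ht j h) (fun h => hT.frozen_cdt t ht j h)

/-! ### Backlog, sign of the credits and packets in progress -/

lemma V_event_nonpos (hT : T.IsRun P) (n : ℕ) (j : Fin p)
    (hb : ¬ T.Backlogged P.c (.avb j) (T.τ n)) : T.V j (T.τ n) ≤ 0 := by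
  cases n with
  | zero => rw [hT.τ_zero, hT.V_zero]
  | succ n =>
    rcases le_or_gt (T.V j (T.τ n) + T.rate j (T.τ n) * (T.τ (n + 1) - T.τ n)) 0 with h | h
    · rwa [hT.V_cont n j (Or.inr h)]
    · exact (hT.R5_reset n j hb h).le

lemma served_step_of_tx (hT : T.IsRun P) {n : ℕ} {t : ℝ}
    (ht : t ∈ Set.Icc (T.τ n) (T.τ (n + 1))) {x : Pkt} (hx : T.line (T.τ n) = LineState.tx x) :
    T.served P.c x t = T.served P.c x (T.τ n) + P.c * (t - T.τ n) :=
  served_of_tx (hT.event_nonneg n) ht.1 fun u hu => by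
    rw [hT.line_const n u ⟨hu.1, hu.2.trans_le ht.2⟩, hx]

lemma served_step_of_not_tx (hT : T.IsRun P) {n : ℕ} {t : ℝ}
    (ht : t ∈ Set.Icc (T.τ n) (T.τ (n + 1))) {x : Pkt} (hx : T.line (T.τ n) ≠ LineState.tx x) :
    T.served P.c x t = T.served P.c x (T.τ n) :=
  served_of_not_tx ht.1 fun u hu => by
    rwa [hT.line_const n u ⟨hu.1, hu.2.trans_le ht.2⟩]

/-- A class that is backlogged at an event stays so until the next one. -/
lemma backlogged_step (hT : T.IsRun P) {n : ℕ} {t : ℝ}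
    (ht : t ∈ Set.Ico (T.τ n) (T.τ (n + 1))) {k : TClass p q}
    (hb : T.Backlogged P.c k (T.τ n)) : T.Backlogged P.c k t := by
  obtain ⟨x, hk, ha, hs⟩ := hb
  refine ⟨x, hk, ha.trans ht.1, ?_⟩
  by_cases hx : T.line (T.τ n) = LineState.tx x
  · exact (hT.tx_valid t ((hT.event_nonneg n).trans ht.1) x
      ((hT.line_const n t ht).trans hx)).2.1
  · rwa [hT.served_step_of_not_tx ⟨ht.1, ht.2.le⟩ hx]

/-- The credit of a class without backlog is not positive. -/
lemma V_nonpos (hT : T.IsRun P) {t : ℝ} (ht : 0 ≤ t) (j : Fin p)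
    (hb : ¬ T.Backlogged P.c (.avb j) t) : T.V j t ≤ 0 := by
  obtain ⟨n, hn⟩ := hT.exists_mem_Ico ht
  -- A positive credit without backlog has slope 0, so it was already positive at the preceding
  -- event, where there was no backlog either.
  by_contra! hV
  have hr := hT.R5_zero t ht j hb hV.le
  rw [hT.rate_const n t hn j] at hr
  have h := hT.V_affine n t hn j
  rw [hr, zero_mul, add_zero] at h
  have := hT.V_event_nonpos n j fun h' => hb (hT.backlogged_step hn h')
  linarith

/-- A positive credit implies backlog by `V_nonpos`, so with an open gate the class would be
eligible. This turns scheduling decisions into signs of credits. -/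
lemma nonpos_of_not_eligible (hT : T.IsRun P) {t : ℝ} (ht : 0 ≤ t) (j : Fin p)
    (hg : T.gate (.avb j) t) (he : ¬ T.Eligible P.c (.avb j) t) : T.V j t ≤ 0 := by
  by_contra! hV
  exact he ⟨by_contra fun hb => absurd (hT.V_nonpos ht j hb) (not_le.mpr hV), hg, hV.le⟩

/-- The amount of the transmitted packet that is served never exceeds its length. -/
lemma served_le_len_of_tx (hT : T.IsRun P) {n : ℕ} {t : ℝ}
    (ht : t ∈ Set.Icc (T.τ n) (T.τ (n + 1))) {x : Pkt} (hx : T.line (T.τ n) = LineState.tx x) :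
    T.served P.c x t ≤ T.len x := by
  rw [hT.served_step_of_tx ht hx]
  have hlt : T.τ n < T.τ (n + 1) := hT.τ_strictMono n.lt_succ_self
  -- `tx_valid` only speaks of instants before the next event; the right endpoint follows by
  -- closure.
  have hcont : ContinuousWithinAt (fun u => T.served P.c x (T.τ n) + P.c * (u - T.τ n))
      (Set.Ico (T.τ n) (T.τ (n + 1))) t := by
    fun_prop
  refine hcont.closure_le (by rwa [closure_Ico hlt.ne]) continuousWithinAt_const fun u hu => ?_
  rw [← hT.served_step_of_tx ⟨hu.1, hu.2.le⟩ hx]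
  exact (hT.tx_valid u ((hT.event_nonneg n).trans hu.1) x
    ((hT.line_const n u hu).trans hx)).2.1.le

/-- Only CDT or overhead can displace a packet that has begun, so while it waits the credits are
frozen along with its served amount. -/
lemma inProgress_of_ne_tx (hT : T.IsRun P) {n : ℕ} {t : ℝ}
    (ht : t ∈ Set.Icc (T.τ n) (T.τ (n + 1))) {x : Pkt} (hx : T.InProgress P.c x t)
    (hne : T.line (T.τ n) ≠ LineState.tx x) :
    T.InProgress P.c x (T.τ n) ∧ T.served P.c x t = T.served P.c x (T.τ n) ∧
      (T.line (T.τ n) = LineState.overhead ∨ T.Transmits .cdt (T.τ n)) := by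
  have hs := hT.served_step_of_not_tx ht hne
  have hp : T.InProgress P.c x (T.τ n) := by
    unfold InProgress at hx ⊢
    rwa [hs] at hx
  refine ⟨hp, hs, ?_⟩
  rcases hT.in_progress _ (hT.event_nonneg n) x hp with h | h | h
  · exact absurd h hne
  · exact Or.inl h
  · exact Or.inr h.2

/-! ### Induction over events -/

lemma V_eq_extendedCredit (hT : T.IsRun P) {n : ℕ} {t : ℝ} (ht : t ∈ Set.Ico (T.τ n) (T.τ (n + 1)))
    (j : Fin p) : T.V j t = T.extendedCredit n t j := hT.V_affine n t ht j

lemma V_event_cases (hT : T.IsRun P) (n : ℕ) (j : Fin p) :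
    T.V j (T.τ (n + 1)) = T.extendedCredit n (T.τ (n + 1)) j ∨
      (T.V j (T.τ (n + 1)) = 0 ∧ 0 < T.extendedCredit n (T.τ (n + 1)) j) := by
  by_cases hb : T.Backlogged P.c (.avb j) (T.τ (n + 1))
  · exact Or.inl (hT.V_cont n j (Or.inl hb))
  rcases le_or_gt (T.extendedCredit n (T.τ (n + 1)) j) 0 with h | h
  · exact Or.inl (hT.V_cont n j (Or.inr h))
  · exact Or.inr ⟨hT.R5_reset n j hb h, h⟩

/-- A property of credits at a time that holds at time `0`, survives resets and propagates between
events holds at all times. -/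
lemma invariant (hT : T.IsRun P) (Q : ℝ → (Fin p → ℝ) → Prop)
    (h0 : Q 0 fun _ => 0)
    (hreset : ∀ t v w, (∀ j, w j = v j ∨ (w j = 0 ∧ 0 < v j)) → Q t v → Q t w)
    (hstep : ∀ n, Q (T.τ n) (fun j => T.V j (T.τ n)) →
      ∀ t ∈ Set.Icc (T.τ n) (T.τ (n + 1)), Q t (T.extendedCredit n t))
    {t : ℝ} (ht : 0 ≤ t) : Q t fun j => T.V j t := by
  have hev : ∀ n, Q (T.τ n) (fun j => T.V j (T.τ n)) := by
    intro n
    induction n with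
    | zero => simpa only [hT.τ_zero, hT.V_zero] using h0
    | succ n ih =>
      -- The right endpoint of the closed interval carries the credits just before a possible reset.
      exact hreset _ _ _ (hT.V_event_cases n)
        (hstep n ih _ ⟨(hT.τ_strictMono n.lt_succ_self).le, le_rfl⟩)
  obtain ⟨n, hn⟩ := hT.exists_mem_Ico ht
  have h := hstep n (hev n) t ⟨hn.1, hn.2.le⟩
  have heq : (fun j => T.V j t) = T.extendedCredit n t := funext fun j => hT.V_eq_extendedCredit hn j
  rwa [heq]

/-! ### Lower bound on the credits -/

/-- Lower bound on the credits. -/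
lemma le_V (hT : T.IsRun P) (j : Fin p) {t : ℝ} (ht : 0 ≤ t) : P.S j * P.L j / P.c ≤ T.V j t := by
  have hc := P.c_pos
  have hS := P.S_neg j
  have hneg : P.S j * P.L j / P.c ≤ 0 :=
    div_nonpos_of_nonpos_of_nonneg (mul_nonpos_of_nonpos_of_nonneg hS.le (P.L_pos j).le) hc.le
  have hserved : ∀ x t, P.S j * T.served P.c x t / P.c ≤ 0 := fun x t =>
    div_nonpos_of_nonpos_of_nonneg
      (mul_nonpos_of_nonpos_of_nonneg hS.le (T.served_nonneg hc.le x t)) hc.le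
  -- The second clause records how far the credit may have fallen when a packet is interrupted, so
  -- that the descent can resume from there.
  refine (hT.invariant (fun t v => P.S j * P.L j / P.c ≤ v j ∧ ∀ x, T.cls x = .avb j →
    T.InProgress P.c x t → P.S j * T.served P.c x t / P.c ≤ v j) ⟨hneg, ?_⟩ ?_ ?_ ht).1
  · exact fun x _ _ => hserved x 0
  · rintro t v w h ⟨h1, h2⟩
    rcases h j with h | ⟨h, -⟩ <;> rw [h]
    exacts [⟨h1, h2⟩, ⟨hneg, fun x _ _ => hserved x t⟩]
  · rintro n ⟨h1, h2⟩ t ht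
    have hn := hT.event_nonneg n
    have hd : 0 ≤ t - T.τ n := sub_nonneg.mpr ht.1
    by_cases htx : T.Transmits (.avb j) (T.τ n)
    · obtain ⟨x, hx, hxj⟩ := htx
      have hV : P.S j * T.served P.c x (T.τ n) / P.c ≤ T.V j (T.τ n) := by
        rcases (T.served_nonneg hc.le x (T.τ n)).eq_or_lt with h0 | hpos
        · have := (hT.R1_select _ hn x hx h0.symm).1.2.2
          rw [hxj] at this
          rw [← h0, mul_zero, zero_div]
          exact this
        · exact h2 x hxj ⟨hpos, (hT.tx_valid _ hn x hx).2.1⟩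
      have hext : P.S j * T.served P.c x t / P.c ≤ T.extendedCredit n t j := by
        rw [hT.served_step_of_tx ht hx, extendedCredit, hT.R2 _ hn j ⟨x, hx, hxj⟩]
        have : P.S j * (T.served P.c x (T.τ n) + P.c * (t - T.τ n)) / P.c =
            P.S j * T.served P.c x (T.τ n) / P.c + P.S j * (t - T.τ n) := by
          field_simp
        linarith
      refine ⟨le_trans ?_ hext, fun y _ hyp => ?_⟩
      · have := (hT.served_le_len_of_tx ht hx).trans (hT.len_avb x j hxj)
        exact div_le_div_of_nonneg_right (mul_le_mul_of_nonpos_left this hS.le) hc.le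
      · by_cases hxy : T.line (T.τ n) = LineState.tx y
        · obtain rfl : x = y := by simpa [hx] using hxy
          exact hext
        -- A second packet in progress would force overhead or CDT on the line, which carries the
        -- AVB packet `x`.
        · rcases (hT.inProgress_of_ne_tx ht hyp hxy).2.2 with h | ⟨z, hz, hzc⟩
          · simp [hx] at h
          · obtain rfl : x = z := by simpa [hx] using hz
            simp [hxj] at hzc
    · have hge : T.V j (T.τ n) ≤ T.extendedCredit n t j :=
        le_add_of_nonneg_right (mul_nonneg (hT.rate_nonneg hn j htx) hd)
      refine ⟨h1.trans hge, fun y hy hyp => ?_⟩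
      obtain ⟨h3, h4, -⟩ := hT.inProgress_of_ne_tx ht hyp fun h => htx ⟨y, h, hy⟩
      rw [h4]
      exact (h2 y hy h3).trans hge

/-! ### Upper bound on the potential -/

lemma len_le_Lbar (hT : T.IsRun P) (i : Fin p) {x : Pkt}
    (hx : (TClass.avb i : TClass p q).rank < (T.cls x).rank) : T.len x ≤ P.Lbar i := by
  cases hk : T.cls x with
  | cdt => simp [hk, TClass.rank] at hx
  | avb j =>
    have hij : i < j := by simpa [hk, TClass.rank] using hx
    exact (hT.len_avb x j hk).trans (P.L_le_Lbar hij)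
  | be k => exact (hT.len_be x k hk).trans (P.LB_le_Lbar i k)

/-- When the line is idle and the potential changes, the credits are not positive. -/
lemma potential_idle (hT : T.IsRun P)
    (hgate : ∀ t : ℝ, 0 ≤ t → ∀ k : TClass p q, k ≠ .cdt → T.gate k t →
      ∀ j : Fin p, T.gate (.avb j) t)
    (i : Fin p) {n : ℕ} (hidle : T.line (T.τ n) = LineState.idle) {t : ℝ}
    (ht : t ∈ Set.Icc (T.τ n) (T.τ (n + 1))) :
    potential P i (T.extendedCredit n t) ≤ max 0 (potential P i fun j => T.V j (T.τ n)) := by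
  by_cases hr : ∀ j, T.rate j (T.τ n) = 0
  · refine le_max_of_le_right (le_of_eq ?_)
    congr 1
    funext j
    simp [extendedCredit, hr j]
  -- A nonzero slope means that the gate of `k` is open; `hgate` then opens all AVB gates, and an
  -- idle line leaves no class with positive credit.
  push Not at hr
  obtain ⟨k, hk⟩ := hr
  refine le_max_of_le_left (potential_nonpos i fun j _ => ?_)
  have hlt : T.τ n < T.τ (n + 1) := hT.τ_strictMono n.lt_succ_self
  have hcont : ContinuousWithinAt (fun u => T.V j (T.τ n) + T.rate j (T.τ n) * (u - T.τ n))
      (Set.Ico (T.τ n) (T.τ (n + 1))) t := by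
    fun_prop
  refine hcont.closure_le (by rwa [closure_Ico hlt.ne]) continuousWithinAt_const fun u hu => ?_
  rw [← hT.V_affine n u hu j]
  have hu0 : 0 ≤ u := (hT.event_nonneg n).trans hu.1
  have hgk : T.gate (.avb k) u := by
    by_contra hg
    exact hk ((hT.rate_const n u hu k).symm.trans (hT.R4_gate u hu0 k hg))
  exact hT.nonpos_of_not_eligible hu0 j (hgate u hu0 _ (by simp) hgk j)
    (hT.R1_work u hu0 ((hT.line_const n u hu).trans hidle) _)

/-- The potential is at most the idle slope times the maximum length of a lower-priority packet. -/
lemma potential_le (hT : T.IsRun P)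
    (hgate : ∀ t : ℝ, 0 ≤ t → ∀ k : TClass p q, k ≠ .cdt → T.gate k t →
      ∀ j : Fin p, T.gate (.avb j) t)
    (i : Fin p) {t : ℝ} (ht : 0 ≤ t) :
    potential P i (fun j => T.V j t) ≤ P.I i * P.Lbar i := by
  have hc := P.c_pos
  have hI := P.I_pos i
  have hB : 0 ≤ P.I i * P.Lbar i := mul_nonneg hI.le (P.Lbar_nonneg i)
  have hzero : potential P i (fun _ => (0 : ℝ)) = 0 := potential_eq_zero i fun _ _ => rfl
  refine (hT.invariant (fun t v => potential P i v ≤ P.I i * P.Lbar i ∧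
    ∀ x, (TClass.avb i : TClass p q).rank < (T.cls x).rank → T.InProgress P.c x t →
      potential P i v ≤ P.I i * T.served P.c x t) ⟨hzero.trans_le hB, ?_⟩ ?_ ?_ ht).1
  · exact fun x _ _ => hzero.trans_le (mul_nonneg hI.le (T.served_nonneg hc.le x 0))
  · rintro t v w h ⟨h1, h2⟩
    have hwv : potential P i w ≤ potential P i v := potential_mono i fun j _ => by
      rcases h j with h | ⟨h, h'⟩ <;> rw [h]
      exact h'.le
    exact ⟨hwv.trans h1, fun x hx hp => hwv.trans (h2 x hx hp)⟩
  · rintro n ⟨h1, h2⟩ t ht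
    have hn := hT.event_nonneg n
    have hd : 0 ≤ t - T.τ n := sub_nonneg.mpr ht.1
    have haff : potential P i (T.extendedCredit n t) = potential P i (fun j => T.V j (T.τ n)) +
        potential P i (fun j => T.rate j (T.τ n)) * (t - T.τ n) := potential_affine i _ _ _
    by_cases hlow : ∃ x, T.line (T.τ n) = LineState.tx x ∧
        (TClass.avb i : TClass p q).rank < (T.cls x).rank
    · obtain ⟨x, hx, hxi⟩ := hlow
      have hncdt : T.cls x ≠ .cdt := fun h => by simp [h, TClass.rank] at hxi
      have hstart : potential P i (fun j => T.V j (T.τ n)) ≤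
          P.I i * T.served P.c x (T.τ n) := by
        -- A fresh packet finds Φ ≤ 0, because every class up to `i` has an open gate and is not
        -- eligible; a resumed one inherits the second clause.
        rcases (T.served_nonneg hc.le x (T.τ n)).eq_or_lt with h0 | hpos
        · rw [← h0, mul_zero]
          refine potential_nonpos i fun j hj => ?_
          refine hT.nonpos_of_not_eligible hn j
            (hgate _ hn _ hncdt (hT.tx_valid _ hn x hx).2.2 j)
            ((hT.R1_select _ hn x hx h0.symm).2 _ (lt_of_le_of_lt ?_ hxi))
          simpa [TClass.rank] using hj
        · exact h2 x hxi ⟨hpos, (hT.tx_valid _ hn x hx).2.1⟩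
      have hext : potential P i (T.extendedCredit n t) ≤ P.I i * T.served P.c x t := by
        rw [haff, hT.served_step_of_tx ht hx]
        have := mul_le_mul_of_nonneg_right (hT.potential_rate_le hn i) hd
        linarith
      refine ⟨hext.trans (mul_le_mul_of_nonneg_left
        ((hT.served_le_len_of_tx ht hx).trans (hT.len_le_Lbar i hxi)) hI.le), fun y _ hyp => ?_⟩
      by_cases hxy : T.line (T.τ n) = LineState.tx y
      · obtain rfl : x = y := by simpa [hx] using hxy
        exact hext
      · rcases (hT.inProgress_of_ne_tx ht hyp hxy).2.2 with h | ⟨z, hz, hzc⟩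
        · simp [hx] at h
        · obtain rfl : x = z := by simpa [hx] using hz
          exact absurd hzc hncdt
    · refine ⟨?_, fun y hy hyp => ?_⟩
      · have hnonpos : potential P i (fun j => T.rate j (T.τ n)) ≤ 0 →
            potential P i (T.extendedCredit n t) ≤ P.I i * P.Lbar i := fun h => by
          rw [haff]
          linarith [mul_nonpos_of_nonpos_of_nonneg h hd]
        cases hl : T.line (T.τ n) with
        | idle => exact (hT.potential_idle hgate i hl ht).trans (max_le hB h1)
        | overhead => exact hnonpos (hT.potential_rate_frozen hn i (Or.inl hl)).le
        | tx x =>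
          have hrank : (T.cls x).rank ≤ (TClass.avb i : TClass p q).rank :=
            not_lt.mp fun h => hlow ⟨x, hl, h⟩
          cases hk : T.cls x with
          | cdt => exact hnonpos (hT.potential_rate_frozen hn i (Or.inr ⟨x, hl, hk⟩)).le
          | avb k =>
            have hki : k ≤ i := by simpa [hk, TClass.rank] using hrank
            exact hnonpos (hT.potential_rate_nonpos hn hki ⟨x, hl, hk⟩)
          | be k =>
            have := i.isLt
            simp only [hk, TClass.rank] at hrank
            omega
      -- An interrupted lower-priority packet waits only for CDT or overhead, so both sides of its
      -- bound stand still.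
      · obtain ⟨h3, h4, h5⟩ := hT.inProgress_of_ne_tx ht hyp fun h => hlow ⟨y, h, hy⟩
        rw [haff, h4, hT.potential_rate_frozen hn i h5, zero_mul, add_zero]
        exact h2 y hy h3

end IsRun

end Trace

end CBS

theorem theorem1 {p q : ℕ} {Pkt : Type*} (P : CBS.Params p q) (T : CBS.Trace p q Pkt)
    (hT : T.IsRun P)
    (hgate : ∀ t : ℝ, 0 ≤ t → ∀ k : CBS.TClass p q, k ≠ CBS.TClass.cdt → T.gate k t →
      ∀ j : Fin p, T.gate (CBS.TClass.avb j) t)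
    (i : Fin p) (t : ℝ) (ht : 0 ≤ t) :
    T.V i t ≤ P.I i / (P.c * (P.c - ∑ j ∈ Finset.univ.filter (fun j => j < i), P.I j)) *
      (P.c * P.Lbar i - ∑ j ∈ Finset.univ.filter (fun j => j < i), P.S j * P.L j) := by
  have hc := P.c_pos
  have hA := P.slack_pos i
  have hpot := hT.potential_le hgate i ht
  have hlow : (∑ j ∈ Finset.univ.filter (fun j => j < i), P.S j * P.L j) / P.c ≤
      ∑ j ∈ Finset.univ.filter (fun j => j < i), T.V j t := by
    rw [Finset.sum_div]
    exact Finset.sum_le_sum fun j _ => hT.le_V j ht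
  have hmul := mul_le_mul_of_nonneg_left hlow (P.I_pos i).le
  simp only [CBS.Trace.potential] at hpot
  change _ ≤ P.I i / (P.c * P.slack i) * _
  generalize ∑ j ∈ Finset.univ.filter (fun j => j < i), P.S j * P.L j = s at hmul ⊢
  have heq : P.I i / (P.c * P.slack i) * (P.c * P.Lbar i - s) =
      (P.I i * P.Lbar i - P.I i * (s / P.c)) / P.slack i := by
    field_simp
  rw [heq, le_div_iff₀ hA]
  linarith
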